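/- Work in $\mathbb{R}^d$ with the Euclidean norm $|\cdot|$; let $\mathcal{C}^d$ be the family of nonempty compact subsets of $\mathbb{R}^d$ and $\mathcal{H}^d$ the $d$-dimensional Hausdorff measure (which is Lebesgue measure). For $K\in\mathcal{C}^d$ and $R>0$ let $d_K(x)$ be the distance from $x$ to $K$, let $K^R=\{x\in\mathbb{R}^d : d_K(x)\le R\}$, and let $p_K(x)$ be the point of $K$ nearest to $x$, which is defined for those $x$ that have exactly one nearest point in $K$ (Lebesgue-almost every $x\in\mathbb{R}^d$). Identify a tensor $T$ of rank $p$ with a $p$-linear form on $\mathbb{R}^d$ through the scalar product, so that $(y_1\otimes\cdots\otimes y_p)(v_1,\dots,v_p)=\prod_i\langle y_i,v_i\rangle$, and put $|T|=\sup\{|T(v_1,\dots,v_p)| : |v_1|=\dots=|v_p|=1\}$. For $r,s\in\mathbb{N}_0$ and $x,y\in\mathbb{R}^d$ let $x^r y^s$ be the symmetric tensor product of $r$ copies of $x$ and $s$ copies of $y$, where $y_1\odot\cdots\odot y_m=\frac{1}{m!}\sum_{\sigma} y_{\sigma(1)}\otimes\cdots\otimes y_{\sigma(m)}$, the sum being over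 all permutations $\sigma$ of $\{1,\dots,m\}$. For a Borel set $A\subseteq\mathbb{R}^d$ define the Voronoi tensor measure $$\mathcal{V}_R^{r,s}(K;A)=\int_{K^R}\mathbf{1}_A(p_K(x))\,p_K(x)^r\,(x-p_K(x))^s\,dx ,$$ a symmetric tensor of rank $r+s$. **Theorem 4.3.** Let $r,s\in\mathbb{N}_0$ and $R>0$. Suppose that $K,K_1,K_2,\ldots\in\mathcal{C}^d$ and that $K_i\to K$ in the Hausdorff metric as $i\to\infty$. Then $$|\mathcal{V}_R^{r,s}(K_i;A)-\mathcal{V}_R^{r,s}(K;A)|\to 0\qquad\text{as } i\to\infty$$ for every Borel set $A\subseteq\mathbb{R}^d$ with $\mathcal{H}^d(p_K^{-1}(\partial A)\cap K^R)=0$. -/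

import Mathlib

open MeasureTheory TopologicalSpace Filter Topology
open scoped RealInnerProductSpace

noncomputable section

namespace VoronoiTensor

/-- Euclidean space of dimension `d`. -/
abbrev E (d : ℕ) : Type := EuclideanSpace ℝ (Fin d)

/-- Tensors of rank `p` over Euclidean space, i.e. `p`-linear forms. The norm that Mathlib puts on
this space is the operator norm `sup |T (v₁, …, v_p)|` over unit vectors `v₁, …, v_p`. -/
abbrev Tensor (d p : ℕ) : Type := ContinuousMultilinearMap ℝ (fun _ : Fin p => E d) ℝ

/-- The tensor product `y₁ ⊗ ⋯ ⊗ y_p`, as the form `(v₁, …, v_p) ↦ ∏ i, ⟪y i, v i⟫`. -/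
def tprod {d p : ℕ} (y : Fin p → E d) : Tensor d p :=
  (ContinuousMultilinearMap.mkPiAlgebra ℝ (Fin p) ℝ).compContinuousLinearMap
    (fun i => innerSL ℝ (y i))

theorem tprod_apply {d p : ℕ} (y v : Fin p → E d) : tprod y v = ∏ i, ⟪y i, v i⟫ := by
  simp [tprod]

/-- The symmetric tensor product `y₁ ⊙ ⋯ ⊙ y_p = (p!)⁻¹ ∑ σ, ⨂ i, y (σ i)`. -/
def symProd {d p : ℕ} (y : Fin p → E d) : Tensor d p :=
  ((p.factorial : ℝ)⁻¹) • ∑ σ : Equiv.Perm (Fin p), tprod (fun i => y (σ i))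

/-- `symProd y` is a symmetric tensor. -/
theorem symProd_symm {d p : ℕ} (y v : Fin p → E d) (τ : Equiv.Perm (Fin p)) :
    symProd y (fun i => v (τ i)) = symProd y v := by
  simp only [symProd, _root_.smul_apply, _root_.sum_apply,
    tprod_apply]
  congr 1
  refine Fintype.sum_equiv (Equiv.mulRight τ⁻¹) _ _ fun σ => ?_
  exact Fintype.prod_equiv τ _ _ fun i => by simp

/-- The symmetric tensor `x^r y^s` of rank `r + s`: the symmetric tensor product of `r` copies
of `x` and `s` copies of `y`. -/
def powMulPow {d : ℕ} (r s : ℕ) (x y : E d) : Tensor d (r + s) :=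
  symProd (Fin.append (fun _ : Fin r => x) (fun _ : Fin s => y))

/-- The domain of the metric projection of `K`: the points that have exactly one nearest point
in `K`. -/
def projDomain {d : ℕ} (K : NonemptyCompacts (E d)) : Set (E d) :=
  {x | ∃! y, y ∈ K ∧ dist x y = Metric.infDist x (K : Set (E d))}

theorem exists_nearest {d : ℕ} (K : NonemptyCompacts (E d)) (x : E d) :
    ∃ y, y ∈ K ∧ dist x y = Metric.infDist x (K : Set (E d)) := by
  obtain ⟨y, hy, h⟩ := K.isCompact.exists_infDist_eq_dist K.nonempty x
  exact ⟨y, hy, h.symm⟩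

/-- The metric projection `p_K`. On `projDomain K` this is the nearest point of `K`; on the
complement, a Lebesgue null set where the metric projection is undefined, the value is some
(arbitrarily chosen) nearest point. -/
def proj {d : ℕ} (K : NonemptyCompacts (E d)) (x : E d) : E d :=
  (exists_nearest K x).choose

theorem proj_spec {d : ℕ} (K : NonemptyCompacts (E d)) (x : E d) :
    proj K x ∈ K ∧ dist x (proj K x) = Metric.infDist x (K : Set (E d)) :=
  (exists_nearest K x).choose_spec

/-- The preimage `p_K⁻¹(B)` under the metric projection as a map defined on `projDomain K`. -/
def projPreimage {d : ℕ} (K : NonemptyCompacts (E d)) (B : Set (E d)) : Set (E d) :=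
  {x | x ∈ projDomain K ∧ proj K x ∈ B}

/-- The Voronoi tensor measure
`V_R^{r,s}(K; A) = ∫_{K^R} 1_A(p_K(x)) p_K(x)^r (x - p_K(x))^s dx`,
where `K^R` is the closed parallel set `{x | d_K(x) ≤ R}`. -/
def voronoi {d : ℕ} (R : ℝ) (r s : ℕ) (K : NonemptyCompacts (E d)) (A : Set (E d)) :
    Tensor d (r + s) :=
  ∫ x in Metric.cthickening R (K : Set (E d)),
    A.indicator (fun _ => (1 : ℝ)) (proj K x) • powMulPow r s (proj K x) (x - proj K x)

end VoronoiTensor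

end

open Metric

namespace VoronoiTensor

variable {d : ℕ}

/-! The proof is dominated convergence over the whole space. Three null sets are discarded: points
without a unique nearest point in `K₀`, points at distance exactly `R` from `K₀`, and points of the
parallel set projecting into `frontier A`. Elsewhere the nearest points converge by compactness, and
both indicators and the continuous tensor factor converge with them. The first set is null by
Rademacher's theorem, since the gradient of the squared distance determines the nearest point; the
second by Lebesgue's density theorem. -/

theorem tendsto_nonemptyCompacts_of_hausdorffDist {K : ℕ → NonemptyCompacts (E d)}
    {K₀ : NonemptyCompacts (E d)}
    (hK : Tendsto (fun i => hausdorffDist (K i : Set (E d)) K₀) atTop (𝓝 0)) :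
    Tendsto K atTop (𝓝 K₀) :=
  tendsto_iff_dist_tendsto_zero.2 hK

theorem proj_mem (K : NonemptyCompacts (E d)) (x : E d) : proj K x ∈ K := (proj_spec K x).1

theorem dist_proj (K : NonemptyCompacts (E d)) (x : E d) :
    dist x (proj K x) = infDist x (K : Set (E d)) := (proj_spec K x).2

theorem mem_cthickening_iff (K : NonemptyCompacts (E d)) {R : ℝ} (hR : 0 ≤ R) (x : E d) :
    x ∈ cthickening R (K : Set (E d)) ↔ infDist x (K : Set (E d)) ≤ R := by
  rw [cthickening_eq_preimage_infEDist, Set.mem_preimage, Set.mem_Iic, infDist,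
    ENNReal.le_ofReal_iff_toReal_le (infEDist_ne_top K.nonempty) hR]

/-- A nearest point is determined by the derivative of the squared distance function. -/
theorem fderiv_sq_infDist {K : NonemptyCompacts (E d)} {x y : E d} (hy : y ∈ K)
    (hxy : dist x y = infDist x (K : Set (E d)))
    (h : DifferentiableAt ℝ (fun z => infDist z (K : Set (E d)) ^ 2) x) :
    fderiv ℝ (fun z => infDist z (K : Set (E d)) ^ 2) x = innerSL ℝ ((2 : ℝ) • (x - y)) := by
  have hd : HasFDerivAt (fun z : E d => ‖z - y‖ ^ 2) (innerSL ℝ ((2 : ℝ) • (x - y))) x := by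
    have := ((hasFDerivAt_id x).sub_const y).norm_sq
    refine this.congr_fderiv ?_
    ext v
    simp [two_smul]
  -- The difference is nonnegative and vanishes at `x`, so its derivative there is zero.
  have hmin : IsLocalMin
      (fun z => ‖z - y‖ ^ 2 - infDist z (K : Set (E d)) ^ 2) x := by
    refine Eventually.of_forall fun z => ?_
    have h0 : ‖x - y‖ ^ 2 - infDist x (K : Set (E d)) ^ 2 = 0 := by
      rw [← hxy, dist_eq_norm, sub_self]
    have h1 : infDist z (K : Set (E d)) ^ 2 ≤ ‖z - y‖ ^ 2 := by
      rw [← dist_eq_norm]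
      exact pow_le_pow_left₀ infDist_nonneg (infDist_le_dist_of_mem hy) 2
    simp only [h0]
    linarith
  exact (sub_eq_zero.1 (hmin.hasFDerivAt_eq_zero (hd.sub h.hasFDerivAt))).symm

theorem ae_differentiableAt_sq_infDist (K : NonemptyCompacts (E d)) :
    ∀ᵐ x : E d, DifferentiableAt ℝ (fun z => infDist z (K : Set (E d)) ^ 2) x := by
  filter_upwards [(lipschitz_infDist_pt (K : Set (E d))).ae_differentiableAt (μ := volume)] with x hx
  exact hx.pow 2

/-- Almost every point has exactly one nearest point in `K`. -/
theorem ae_mem_projDomain (K : NonemptyCompacts (E d)) : ∀ᵐ x : E d, x ∈ projDomain K := by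
  filter_upwards [ae_differentiableAt_sq_infDist K] with x hx
  refine ⟨proj K x, proj_spec K x, fun y hy => ?_⟩
  have h := (fderiv_sq_infDist hy.1 hy.2 hx).symm.trans
    (fderiv_sq_infDist (proj_mem K x) (dist_proj K x) hx)
  have h' := (innerSL_inj (𝕜 := ℝ)).1 h
  simpa using h'

/-- Although `proj` is made by choice, it agrees almost everywhere with `x - ∇(d_K²)(x) / 2`, and
derivatives are measurable. -/
theorem aemeasurable_proj (K : NonemptyCompacts (E d)) : AEMeasurable (proj K) := by
  set g : E d → ℝ := fun z => infDist z (K : Set (E d)) ^ 2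
  refine ⟨fun x => x - (2 : ℝ)⁻¹ • (InnerProductSpace.toDual ℝ (E d)).symm (fderiv ℝ g x), ?_, ?_⟩
  · have hm : Measurable fun x => (InnerProductSpace.toDual ℝ (E d)).symm (fderiv ℝ g x) :=
      (InnerProductSpace.toDual ℝ (E d)).symm.continuous.measurable.comp (measurable_fderiv ℝ g)
    exact measurable_id.sub (hm.const_smul (2 : ℝ)⁻¹)
  · filter_upwards [ae_differentiableAt_sq_infDist K] with x hx
    have h := fderiv_sq_infDist (proj_mem K x) (dist_proj K x) hx
    have h' : (InnerProductSpace.toDual ℝ (E d)).symm (fderiv ℝ g x)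
        = (2 : ℝ) • (x - proj K x) := by
      rw [LinearIsometryEquiv.symm_apply_eq]
      exact h
    rw [h', smul_smul]
    norm_num

/-- The boundary of the parallel set is a null set, since none of its points is a density point. -/
theorem volume_setOf_infDist_eq (K : NonemptyCompacts (E d)) {R : ℝ} (hR : 0 < R) :
    volume {x : E d | infDist x (K : Set (E d)) = R} = 0 := by
  set S := {x : E d | infDist x (K : Set (E d)) = R} with hS
  have hSm : MeasurableSet S :=
    (isClosed_singleton.preimage (continuous_infDist_pt (K : Set (E d)))).measurableSet
  -- The factor `2` admits balls of radius `t` whose centre is at distance `2 * t` from `x`.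
  have key := IsUnifLocDoublingMeasure.ae_tendsto_measure_inter_div (volume : Measure (E d)) S 2
  rw [ae_restrict_iff' hSm] at key
  suffices h : ∀ᵐ x : E d, x ∉ S by simpa [ae_iff] using h
  filter_upwards [key] with x hx hxS
  have hdist : dist x (proj K x) = R := (dist_proj K x).trans hxS
  set p := proj K x
  -- Moving `x` by `2 * t` towards `p` puts the ball of radius `t` within distance `R - t` of `p`,
  -- hence off the level set.
  set w : ℝ → E d := fun t => x + (2 * t / R) • (p - x)
  have hxp : ‖p - x‖ = R := by rw [← dist_eq_norm, dist_comm, hdist]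
  have ht := hx hxS (l := 𝓝[>] (0 : ℝ)) w id tendsto_id (by
    filter_upwards [self_mem_nhdsWithin] with t (ht : 0 < t)
    rw [mem_closedBall, dist_eq_norm, sub_add_cancel_left, norm_neg, norm_smul, hxp,
      Real.norm_of_nonneg (by positivity)]
    simp [hR.ne'])
  have hzero : ∀ᶠ t in 𝓝[>] (0 : ℝ),
      volume (S ∩ closedBall (w t) (id t)) / volume (closedBall (w t) (id t)) = 0 := by
    filter_upwards [self_mem_nhdsWithin, nhdsWithin_le_nhds (Iio_mem_nhds (half_pos hR))]
      with t (ht : 0 < t) (htR : t < R / 2)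
    have hempty : S ∩ closedBall (w t) (id t) = ∅ := by
      refine Set.eq_empty_of_forall_notMem fun z hz => ?_
      have h1 : infDist z (K : Set (E d)) ≤ dist z p := infDist_le_dist_of_mem (proj_mem K x)
      have h2 : dist z (w t) ≤ t := hz.2
      have h3 : dist (w t) p = R - 2 * t := by
        have : w t - p = (2 * t / R - 1) • (p - x) := by
          simp only [w, sub_smul, one_smul]
          abel
        rw [dist_eq_norm, this, norm_smul, hxp, Real.norm_of_nonpos]
        · field_simp
          ring
        · rw [sub_nonpos, div_le_one hR]
          linarith
      have h4 : infDist z (K : Set (E d)) = R := hz.1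
      have h5 := dist_triangle z (w t) p
      linarith
    rw [hempty]
    simp
  exact zero_ne_one (tendsto_nhds_unique (tendsto_const_nhds.congr' (hzero.mono fun _ h => h.symm)) ht)

theorem MapClusterPt.eq_of_tendsto {ι X Y : Type*} [TopologicalSpace X] [TopologicalSpace Y]
    [T2Space Y] {l : Filter ι} {f : ι → X} {y : X} {g : X → Y} {c : Y} (hy : MapClusterPt y l f)
    (hg : Continuous g) (h : Tendsto (fun i => g (f i)) l (𝓝 c)) : g y = c := by
  have h1 : MapClusterPt (g y) l (g ∘ f) := hy.continuousAt_comp hg.continuousAt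
  exact eq_of_nhds_neBot (ClusterPt.mono h1 h)

theorem tendsto_infDist {K : ℕ → NonemptyCompacts (E d)} {K₀ : NonemptyCompacts (E d)}
    (hK : Tendsto K atTop (𝓝 K₀)) (x : E d) :
    Tendsto (fun i => infDist x (K i : Set (E d))) atTop (𝓝 (infDist x (K₀ : Set (E d)))) :=
  ((Metric.lipschitz_infDist_set x).continuous.tendsto K₀).comp hK

theorem infDist_le_dist_nonemptyCompacts {K L : NonemptyCompacts (E d)} {y : E d} (hy : y ∈ K) :
    infDist y (L : Set (E d)) ≤ dist K L :=
  infDist_le_hausdorffDist_of_mem hy (hausdorffEDist_ne_top_of_nonempty_of_bounded K.nonempty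
    L.nonempty K.isCompact.isBounded L.isCompact.isBounded)

/-- Nearest points converge at every point where the limit set has a unique nearest point. -/
theorem tendsto_proj {K : ℕ → NonemptyCompacts (E d)} {K₀ : NonemptyCompacts (E d)}
    (hK : Tendsto K atTop (𝓝 K₀)) {x : E d} (hx : x ∈ projDomain K₀) :
    Tendsto (fun i => proj (K i) x) atTop (𝓝 (proj K₀ x)) := by
  have h1 : Tendsto (fun i => dist x (proj (K i) x)) atTop (𝓝 (infDist x (K₀ : Set (E d)))) := by
    simpa only [dist_proj] using tendsto_infDist hK x
  have h2 : Tendsto (fun i => infDist (proj (K i) x) (K₀ : Set (E d))) atTop (𝓝 0) :=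
    squeeze_zero (fun _ => infDist_nonneg)
      (fun i => infDist_le_dist_nonemptyCompacts (proj_mem (K i) x))
      (tendsto_iff_dist_tendsto_zero.1 hK)
  refine (isCompact_closedBall x (infDist x (K₀ : Set (E d)) + 1)).tendsto_nhds_of_unique_mapClusterPt
    ?_ fun y _ hy => ?_
  · filter_upwards [h1.eventually_le_const (lt_add_one _)] with i hi
    rwa [mem_closedBall, dist_comm]
  -- Any cluster point lies in `K₀` and realises the distance, so uniqueness identifies it.
  · have e1 : dist x y = infDist x (K₀ : Set (E d)) :=
      MapClusterPt.eq_of_tendsto (g := fun y => dist x y) hy (by fun_prop) h1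
    have e2 : infDist y (K₀ : Set (E d)) = 0 :=
      MapClusterPt.eq_of_tendsto (g := fun y => infDist y (K₀ : Set (E d))) hy
        (continuous_infDist_pt _) h2
    have hyK : y ∈ K₀ :=
      (K₀.isCompact.isClosed.mem_iff_infDist_zero K₀.nonempty).2 e2
    exact hx.unique ⟨hyK, e1⟩ (proj_spec K₀ x)

theorem continuous_tprod {p : ℕ} : Continuous (tprod : (Fin p → E d) → Tensor d p) := by
  have h := (ContinuousMultilinearMap.compContinuousLinearMapContinuousMultilinear ℝ
    (fun _ : Fin p => E d) (fun _ : Fin p => ℝ) ℝ).cont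
  have h' : Continuous fun y : Fin p → E d => fun i => innerSL ℝ (y i) :=
    continuous_pi fun i => (innerSL ℝ).continuous.comp (continuous_apply i)
  exact (h.comp h').clm_apply continuous_const

theorem continuous_symProd {p : ℕ} : Continuous (symProd : (Fin p → E d) → Tensor d p) := by
  unfold symProd
  have h (σ : Equiv.Perm (Fin p)) :
      Continuous fun y : Fin p → E d => tprod (fun i => y (σ i)) :=
    continuous_tprod.comp (continuous_pi fun i => continuous_apply (σ i))
  have hsum : Continuous fun y : Fin p → E d =>
      ∑ σ : Equiv.Perm (Fin p), tprod (fun i => y (σ i)) :=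
    continuous_finsetSum _ fun σ _ => h σ
  exact hsum.const_smul (p.factorial : ℝ)⁻¹

theorem continuous_powMulPow (r s : ℕ) :
    Continuous fun q : E d × E d => powMulPow r s q.1 q.2 := by
  refine continuous_symProd.comp (continuous_pi fun i => ?_)
  refine Fin.addCases (fun j => ?_) (fun j => ?_) i
  · simpa using continuous_fst
  · simpa using continuous_snd

/-- The integrand of the Voronoi tensor measure. -/
noncomputable def integrand (r s : ℕ) (K : NonemptyCompacts (E d)) (A : Set (E d)) (x : E d) :
    Tensor d (r + s) :=
  A.indicator (fun _ => (1 : ℝ)) (proj K x) • powMulPow r s (proj K x) (x - proj K x)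

theorem aestronglyMeasurable_integrand (r s : ℕ) (K : NonemptyCompacts (E d)) {A : Set (E d)}
    (hA : MeasurableSet A) : AEStronglyMeasurable (integrand r s K A) := by
  have hp := aemeasurable_proj K
  have h1 : AEStronglyMeasurable fun x => A.indicator (fun _ => (1 : ℝ)) (proj K x) :=
    ((measurable_const.indicator hA).comp_aemeasurable hp).aestronglyMeasurable
  have h2 : AEStronglyMeasurable fun x => powMulPow r s (proj K x) (x - proj K x) :=
    Continuous.comp_aestronglyMeasurable (g := fun q : E d × E d => powMulPow r s q.1 q.2)
      (f := fun x => (proj K x, x - proj K x)) (continuous_powMulPow r s)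
      (hp.aestronglyMeasurable.prodMk (aemeasurable_id'.sub hp).aestronglyMeasurable)
  exact h1.smul h2

theorem voronoi_eq_integral_indicator (R : ℝ) (r s : ℕ) (K : NonemptyCompacts (E d))
    (A : Set (E d)) :
    voronoi R r s K A = ∫ x, (cthickening R (K : Set (E d))).indicator (integrand r s K A) x :=
  (integral_indicator isClosed_cthickening.measurableSet).symm

theorem norm_integrand_le (r s : ℕ) (K : NonemptyCompacts (E d)) (A : Set (E d)) (x : E d) :
    ‖integrand r s K A x‖ ≤ ‖powMulPow r s (proj K x) (x - proj K x)‖ := by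
  rw [integrand, norm_smul]
  refine mul_le_of_le_one_left (norm_nonneg _) ?_
  by_cases h : proj K x ∈ A <;> simp [h]

theorem tendsto_integrand {r s : ℕ} {K : ℕ → NonemptyCompacts (E d)}
    {K₀ : NonemptyCompacts (E d)} (hK : Tendsto K atTop (𝓝 K₀)) {A : Set (E d)} {x : E d}
    (hx : x ∈ projDomain K₀) (hxA : proj K₀ x ∉ frontier A) :
    Tendsto (fun i => integrand r s (K i) A x) atTop (𝓝 (integrand r s K₀ A x)) := by
  have hp := tendsto_proj hK hx
  have h1 : ContinuousAt (A.indicator fun _ => (1 : ℝ)) (proj K₀ x) :=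
    continuous_const.continuousOn.continuousAt_indicator hxA
  have h2 : Tendsto (fun i => (proj (K i) x, x - proj (K i) x)) atTop
      (𝓝 (proj K₀ x, x - proj K₀ x)) :=
    hp.prodMk_nhds (hp.const_sub x)
  have h3 : Tendsto (fun i => powMulPow r s (proj (K i) x) (x - proj (K i) x)) atTop
      (𝓝 (powMulPow r s (proj K₀ x) (x - proj K₀ x))) := by
    have h := ((continuous_powMulPow (d := d) r s).tendsto (proj K₀ x, x - proj K₀ x)).comp h2
    simpa only [Function.comp_def] using h
  have h4 : Tendsto (fun i => A.indicator (fun _ => (1 : ℝ)) (proj (K i) x)) atTop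
      (𝓝 (A.indicator (fun _ => (1 : ℝ)) (proj K₀ x))) := h1.tendsto.comp hp
  unfold integrand
  exact h4.smul h3

/-- Distances to `K i` converge, so off the level set membership of `x` in the parallel sets is
eventually constant. -/
theorem tendsto_indicator_cthickening {F : Type*} [TopologicalSpace F] [Zero F] {R : ℝ}
    (hR : 0 ≤ R) {K : ℕ → NonemptyCompacts (E d)} {K₀ : NonemptyCompacts (E d)}
    (hK : Tendsto K atTop (𝓝 K₀)) {f : ℕ → E d → F} {f₀ : E d → F} {x : E d}
    (hx : infDist x (K₀ : Set (E d)) ≠ R)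
    (hf : x ∈ cthickening R (K₀ : Set (E d)) → Tendsto (fun i => f i x) atTop (𝓝 (f₀ x))) :
    Tendsto (fun i => (cthickening R (K i : Set (E d))).indicator (f i) x) atTop
      (𝓝 ((cthickening R (K₀ : Set (E d))).indicator f₀ x)) := by
  have hd := tendsto_infDist hK x
  rcases hx.lt_or_gt with h | h
  · have hmem := (mem_cthickening_iff K₀ hR x).2 h.le
    rw [Set.indicator_of_mem hmem]
    refine (hf hmem).congr' ?_
    filter_upwards [hd.eventually_lt_const h] with i hi
    rw [Set.indicator_of_mem ((mem_cthickening_iff (K i) hR x).2 hi.le)]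
  · rw [Set.indicator_of_notMem (by rw [mem_cthickening_iff _ hR]; exact h.not_ge)]
    refine tendsto_const_nhds.congr' ?_
    filter_upwards [hd.eventually_const_lt h] with i hi
    rw [Set.indicator_of_notMem (by rw [mem_cthickening_iff _ hR]; exact hi.not_ge)]

/-- A bound, uniform over compact sets close to `K₀`, for the integrand on the parallel set. -/
theorem exists_integrable_bound (r s : ℕ) {R : ℝ} (hR : 0 ≤ R) (K₀ : NonemptyCompacts (E d))
    (A : Set (E d)) :
    ∃ b : E d → ℝ, Integrable b ∧ ∀ K : NonemptyCompacts (E d), dist K K₀ ≤ 1 → ∀ x,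
      ‖(cthickening R (K : Set (E d))).indicator (integrand r s K A) x‖ ≤ b x := by
  have hC : IsCompact (cthickening (1 : ℝ) (K₀ : Set (E d))) := K₀.isCompact.cthickening
  have hB : IsCompact (cthickening (R + 1) (K₀ : Set (E d))) := K₀.isCompact.cthickening
  have hcont : Continuous fun q : E d × E d => powMulPow r s q.1 (q.2 - q.1) := by
    have h := (continuous_powMulPow (d := d) r s).comp
      (continuous_fst.prodMk (continuous_snd.sub continuous_fst))
    simpa only [Function.comp_def, Pi.sub_apply] using h
  obtain ⟨M, hM⟩ := (hC.prod hB).exists_bound_of_continuousOn hcont.continuousOn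
  refine ⟨(cthickening (R + 1) (K₀ : Set (E d))).indicator fun _ => M,
    (integrableOn_const hB.measure_lt_top.ne).integrable_indicator
      isClosed_cthickening.measurableSet, fun K hKK x => ?_⟩
  have hp : proj K x ∈ cthickening (1 : ℝ) (K₀ : Set (E d)) :=
    (mem_cthickening_iff K₀ zero_le_one _).2
      ((infDist_le_dist_nonemptyCompacts (proj_mem K x)).trans hKK)
  have hM' (z : E d) (hz : z ∈ cthickening (R + 1) (K₀ : Set (E d))) :
      ‖powMulPow r s (proj K x) (z - proj K x)‖ ≤ M := by
    simpa only using hM (proj K x, z) (Set.mk_mem_prod hp hz)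
  by_cases hx : x ∈ cthickening R (K : Set (E d))
  · have hx' : x ∈ cthickening (R + 1) (K₀ : Set (E d)) := by
      rw [mem_cthickening_iff _ (by linarith)]
      rw [mem_cthickening_iff _ hR, ← dist_proj] at hx
      have h1 := infDist_le_infDist_add_dist (s := (K₀ : Set (E d))) (x := x) (y := proj K x)
      have h2 := infDist_le_dist_nonemptyCompacts (L := K₀) (proj_mem K x)
      linarith
    rw [Set.indicator_of_mem hx, Set.indicator_of_mem hx']
    exact (norm_integrand_le r s K A x).trans (hM' x hx')
  · rw [Set.indicator_of_notMem hx, norm_zero]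
    -- `M ≥ 0` is needed only where the larger parallel set has a point `z`, and there `M` bounds a
    -- norm.
    refine Set.indicator_nonneg (fun z hz => ?_) x
    exact (norm_nonneg _).trans (hM' z hz)

end VoronoiTensor

open VoronoiTensor in
theorem tendsto_voronoi {d r s : ℕ} {R : ℝ} (hR : 0 < R) {K : ℕ → NonemptyCompacts (E d)}
    {K₀ : NonemptyCompacts (E d)} (hK : Tendsto K atTop (𝓝 K₀)) {A : Set (E d)}
    (hA : MeasurableSet A)
    (hAK : volume (projPreimage K₀ (frontier A) ∩ cthickening R (K₀ : Set (E d))) = 0) :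
    Tendsto (fun i => voronoi R r s (K i) A) atTop (𝓝 (voronoi R r s K₀ A)) := by
  simp only [voronoi_eq_integral_indicator]
  obtain ⟨b, hb, hbound⟩ := exists_integrable_bound r s hR.le K₀ A
  refine tendsto_integral_filter_of_dominated_convergence b ?_ ?_ hb ?_
  · exact Eventually.of_forall fun i => (aestronglyMeasurable_integrand r s (K i) hA).indicator
      isClosed_cthickening.measurableSet
  · filter_upwards [(tendsto_iff_dist_tendsto_zero.1 hK).eventually_le_const zero_lt_one] with i hi
    exact Eventually.of_forall (hbound (K i) hi)
  · have hlevel : ∀ᵐ x : E d, infDist x (K₀ : Set (E d)) ≠ R := by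
      simpa [ae_iff] using volume_setOf_infDist_eq K₀ hR
    filter_upwards [ae_mem_projDomain K₀, measure_eq_zero_iff_ae_notMem.1 hAK, hlevel]
      with x hx hxA hxR
    exact tendsto_indicator_cthickening hR.le hK hxR fun hxK =>
      tendsto_integrand hK hx fun hf => hxA ⟨⟨hx, hf⟩, hxK⟩

theorem theorem4p3 (d r s : ℕ) (R : ℝ) (hR : 0 < R)
    (K : ℕ → NonemptyCompacts (VoronoiTensor.E d)) (K₀ : NonemptyCompacts (VoronoiTensor.E d))
    (hK : Tendsto (fun i => Metric.hausdorffDist (K i : Set (VoronoiTensor.E d)) K₀)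
      atTop (𝓝 0))
    (A : Set (VoronoiTensor.E d)) (hA : MeasurableSet A)
    (hAK : Measure.euclideanHausdorffMeasure d (VoronoiTensor.projPreimage K₀ (frontier A) ∩
      Metric.cthickening R (K₀ : Set (VoronoiTensor.E d))) = 0) :
    Tendsto (fun i => ‖VoronoiTensor.voronoi R r s (K i) A - VoronoiTensor.voronoi R r s K₀ A‖)
      atTop (𝓝 0) := by
  rw [EuclideanSpace.euclideanHausdorffMeasure_eq_volume] at hAK
  exact tendsto_iff_norm_sub_tendsto_zero.1
    (tendsto_voronoi hR (VoronoiTensor.tendsto_nonemptyCompacts_of_hausdorffDist hK) hA hAK)
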